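/- Let $X$ be a finite set and let $R_0,\dots,R_4\subseteq X\times X$ be non-empty relations, with adjacency matrices $A_0,\dots,A_4$, that form a symmetric association scheme with $4$ classes: $A_0=I$, $\sum_i A_i=J$ (the all-one matrix), $A_i^{\top}=A_i$, and every product $A_iA_j$ is a linear combination of $A_0,\dots,A_4$ with nonnegative integer coefficients. Let $E_0=\frac1{|X|}J,E_1,\dots,E_4$ be an ordering of the primitive idempotents of the real span of the $A_i$, write $E_i=\frac1{|X|}\sum_j Q_{ji}A_j$, and define the Krein parameters $q_{ij}^k$ by $E_i\circ E_j=\frac1{|X|}\sum_k q_{ij}^kE_k$, where $\circ$ is the entrywise product. Suppose that the ordering is $Q$-polynomial, i.e. for each $i$ there is a real polynomial $v_i^*$ of degree $i$ with $Q_{ji}=v_i^*(Q_{j1})$ for all $j$, and that for some integers $m$ and $r$ its Krein array $\{b_0^*,b_1^*,b_2^*,b_3^*;c_1^*,c_2^*,c_3^*,c_4^*\}$, where $b_i^*=q_{1,i+1}^i$ and $c_i^*=q_{1,i-1}^i$, is $$\Bigl\{m,\ m-1,\ \frac{m(r^2-1)}{r^2},\ m-r^2+1;\ 1,\ \frac{m}{r^2},\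 r^2-1,\ m\Bigr\}$$ (a scheme of "Latin square type"). Then: (i) $m$ is not odd; in other words, a $Q$-polynomial association scheme with this Krein array and $m$ odd does not exist. (ii) If moreover $r>0$ and the relations are in the natural ordering $Q_{01}>Q_{11}>Q_{21}>Q_{31}>Q_{41}$, then for all $x,y,z\in X$ with $(x,y),(x,z)\in R_1$ and $(y,z)\in R_2$, $$[1\ 1\ 3]=r+\frac{r^2(1-r)}2-\frac m2+[1\ 1\ 1],$$ where $[i\ j\ k]$ is the number of $w\in X$ with $(x,w)\in R_i$, $(y,w)\in R_j$ and $(z,w)\in R_k$. -/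

import Mathlib

open scoped Matrix

noncomputable section

/-- The adjacency matrix (over `ℝ`) of a binary relation on `X`. -/
def relMatrix {X : Type*} (R : Set (X × X)) : Matrix X X ℝ :=
  Matrix.of fun x y => R.indicator (fun _ => (1 : ℝ)) (x, y)

/-- A symmetric association scheme with `D` classes on the finite vertex set `X`. -/
structure AssociationScheme (X : Type*) [Fintype X] [DecidableEq X] (D : ℕ) where
  /-- the relations `R₀, …, R_D` -/
  R : Fin (D + 1) → Set (X × X)
  nonempty : ∀ i, (R i).Nonempty
  adj_zero : relMatrix (R 0) = 1
  sum_adj : ∑ i, relMatrix (R i) = Matrix.of fun _ _ => (1 : ℝ)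
  adj_symm : ∀ i, (relMatrix (R i))ᵀ = relMatrix (R i)
  adj_mul : ∀ i j, ∃ p : Fin (D + 1) → ℕ,
    relMatrix (R i) * relMatrix (R j) = ∑ k, (p k : ℝ) • relMatrix (R k)

namespace AssociationScheme

variable {X : Type*} [Fintype X] [DecidableEq X] {D : ℕ}

/-- The adjacency matrix `A_i` of the relation `R_i`. -/
def A (S : AssociationScheme X D) (i : Fin (D + 1)) : Matrix X X ℝ := relMatrix (S.R i)

/-- The Bose–Mesner algebra: the real span of the adjacency matrices. -/
def boseMesner (S : AssociationScheme X D) : Submodule ℝ (Matrix X X ℝ) :=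
  Submodule.span ℝ (Set.range S.A)

theorem A_apply_of_mem (S : AssociationScheme X D) {i : Fin (D + 1)} {x y : X}
    (h : (x, y) ∈ S.R i) : S.A i x y = 1 := by
  simp [A, relMatrix, h]

theorem A_apply_of_notMem (S : AssociationScheme X D) {i : Fin (D + 1)} {x y : X}
    (h : (x, y) ∉ S.R i) : S.A i x y = 0 := by
  simp [A, relMatrix, h]

theorem A_nonneg (S : AssociationScheme X D) (i : Fin (D + 1)) (x y : X) : 0 ≤ S.A i x y := by
  by_cases h : (x, y) ∈ S.R i
  · simp [S.A_apply_of_mem h]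
  · simp [S.A_apply_of_notMem h]

theorem sum_A_apply (S : AssociationScheme X D) (x y : X) : ∑ i, S.A i x y = 1 := by
  have h := congrFun (congrFun S.sum_adj x) y
  simpa [Matrix.sum_apply, A] using h

theorem eq_of_mem (S : AssociationScheme X D) {i j : Fin (D + 1)} {x y : X}
    (hi : (x, y) ∈ S.R i) (hj : (x, y) ∈ S.R j) : i = j := by
  by_contra hij
  have h1 : ∑ k ∈ ({i, j} : Finset (Fin (D + 1))), S.A k x y ≤ ∑ k, S.A k x y :=
    Finset.sum_le_sum_of_subset_of_nonneg (Finset.subset_univ _) fun k _ _ => S.A_nonneg k x y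
  rw [Finset.sum_pair hij, S.sum_A_apply, S.A_apply_of_mem hi, S.A_apply_of_mem hj] at h1
  norm_num at h1

theorem A_linearIndependent (S : AssociationScheme X D) : LinearIndependent ℝ S.A := by
  rw [Fintype.linearIndependent_iff]
  intro g hg i
  obtain ⟨⟨x, y⟩, hxy⟩ := S.nonempty i
  have h := congrFun (congrFun hg x) y
  rw [Matrix.sum_apply, Finset.sum_eq_single i] at h
  · simpa [S.A_apply_of_mem hxy] using h
  · intro j _ hj
    have : (x, y) ∉ S.R j := fun hxj => hj (S.eq_of_mem hxj hxy)
    simp [S.A_apply_of_notMem this]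
  · simp

/-- The adjacency matrices as a basis of the Bose–Mesner algebra. -/
def adjBasis (S : AssociationScheme X D) : Module.Basis (Fin (D + 1)) ℝ S.boseMesner :=
  Module.Basis.span S.A_linearIndependent

theorem adjBasis_apply (S : AssociationScheme X D) (i : Fin (D + 1)) :
    (S.adjBasis i : Matrix X X ℝ) = S.A i :=
  congrArg Subtype.val (Module.Basis.span_apply S.A_linearIndependent i)

/-- The Bose–Mesner algebra is closed under the entrywise product. -/
theorem hadamard_mem (S : AssociationScheme X D) {M N : Matrix X X ℝ}
    (hM : M ∈ S.boseMesner) (hN : N ∈ S.boseMesner) : M ⊙ N ∈ S.boseMesner := by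
  unfold boseMesner at hM hN
  induction hM using Submodule.span_induction with
  | zero => simp
  | add a b _ _ ha hb => rw [Matrix.add_hadamard]; exact Submodule.add_mem _ ha hb
  | smul c a _ ha => rw [Matrix.smul_hadamard]; exact Submodule.smul_mem _ _ ha
  | mem a ha =>
    obtain ⟨i, rfl⟩ := ha
    induction hN using Submodule.span_induction with
    | zero => simp
    | add a b _ _ ha hb => rw [Matrix.hadamard_add]; exact Submodule.add_mem _ ha hb
    | smul c a _ ha => rw [Matrix.hadamard_smul]; exact Submodule.smul_mem _ _ ha
    | mem b hb =>
      obtain ⟨j, rfl⟩ := hb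
      by_cases hij : i = j
      · subst hij
        have : S.A i ⊙ S.A i = S.A i := by
          ext x y
          by_cases h : (x, y) ∈ S.R i
          · simp [Matrix.hadamard_apply, S.A_apply_of_mem h]
          · simp [Matrix.hadamard_apply, S.A_apply_of_notMem h]
        rw [this]
        exact Submodule.subset_span ⟨i, rfl⟩
      · have : S.A i ⊙ S.A j = 0 := by
          ext x y
          by_cases h : (x, y) ∈ S.R i
          · have : (x, y) ∉ S.R j := fun h' => hij (S.eq_of_mem h h')
            simp [Matrix.hadamard_apply, S.A_apply_of_notMem this]
          · simp [Matrix.hadamard_apply, S.A_apply_of_notMem h]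
        rw [this]
        exact Submodule.zero_mem _

/-- The triple intersection number `[i j k]` for the triple of vertices `(x, y, z)`: the number of
vertices `w` with `(x, w) ∈ R_i`, `(y, w) ∈ R_j` and `(z, w) ∈ R_k`. -/
def tripleNumber (S : AssociationScheme X D) (x y z : X) (i j k : Fin (D + 1)) : ℕ :=
  {w : X | (x, w) ∈ S.R i ∧ (y, w) ∈ S.R j ∧ (z, w) ∈ S.R k}.ncard

/-- An ordering `E₀ = J / |X|, E₁, …, E_D` of the primitive idempotents of the Bose–Mesner algebra.
(A basis of this `D + 1`-dimensional commutative algebra that consists of pairwise orthogonal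
idempotents necessarily consists of all the primitive idempotents.) -/
structure IdempotentOrdering (S : AssociationScheme X D) where
  basis : Module.Basis (Fin (D + 1)) ℝ S.boseMesner
  mul_eq : ∀ i j, (basis i : Matrix X X ℝ) * (basis j : Matrix X X ℝ) =
    if i = j then (basis i : Matrix X X ℝ) else 0
  basis_zero : (basis 0 : Matrix X X ℝ) = Matrix.of fun _ _ => 1 / (Fintype.card X : ℝ)

namespace IdempotentOrdering

variable {S : AssociationScheme X D}

/-- The primitive idempotent `E_i`. -/
def E (O : S.IdempotentOrdering) (i : Fin (D + 1)) : Matrix X X ℝ := O.basis i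

/-- The entry `Q_{ji}` of the second eigenmatrix: `E_i = |X|⁻¹ ∑ⱼ Q_{ji} A_j`. -/
def Q (O : S.IdempotentOrdering) (j i : Fin (D + 1)) : ℝ :=
  (Fintype.card X : ℝ) * S.adjBasis.repr (O.basis i) j

/-- The Krein parameter `q_{ij}^k`: `E_i ∘ E_j = |X|⁻¹ ∑ₖ q_{ij}^k E_k`. -/
def krein (O : S.IdempotentOrdering) (i j k : Fin (D + 1)) : ℝ :=
  (Fintype.card X : ℝ) *
    O.basis.repr ⟨O.E i ⊙ O.E j, S.hadamard_mem (O.basis i).2 (O.basis j).2⟩ k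

theorem card_ne_zero (_O : S.IdempotentOrdering) : (Fintype.card X : ℝ) ≠ 0 := by
  obtain ⟨⟨x, _⟩, _⟩ := S.nonempty 0
  have : Nonempty X := ⟨x⟩
  exact_mod_cast Fintype.card_ne_zero

theorem E_eq_sum (O : S.IdempotentOrdering) (i : Fin (D + 1)) :
    O.E i = (Fintype.card X : ℝ)⁻¹ • ∑ j, O.Q j i • S.A j := by
  have h := congrArg (Subtype.val : S.boseMesner → Matrix X X ℝ) (S.adjBasis.sum_repr (O.basis i))
  simp only [Submodule.coe_sum, Submodule.coe_smul, S.adjBasis_apply] at h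
  rw [E, ← h, Finset.smul_sum]
  refine Finset.sum_congr rfl fun j _ => ?_
  rw [smul_smul, Q, inv_mul_cancel_left₀ O.card_ne_zero]

theorem E_hadamard_E (O : S.IdempotentOrdering) (i j : Fin (D + 1)) :
    O.E i ⊙ O.E j = (Fintype.card X : ℝ)⁻¹ • ∑ k, O.krein i j k • O.E k := by
  have h := congrArg (Subtype.val : S.boseMesner → Matrix X X ℝ)
    (O.basis.sum_repr ⟨O.E i ⊙ O.E j, S.hadamard_mem (O.basis i).2 (O.basis j).2⟩)
  simp only [Submodule.coe_sum, Submodule.coe_smul] at h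
  rw [← h, Finset.smul_sum]
  refine Finset.sum_congr rfl fun k _ => ?_
  rw [smul_smul, krein, inv_mul_cancel_left₀ O.card_ne_zero]
  rfl

/-- The ordering of idempotents is `Q`-polynomial: for each `i` there is a polynomial `v` of degree
exactly `i` with `Q_{ji} = v(Q_{j1})` for all `j`. -/
def IsQPolynomial (O : S.IdempotentOrdering) : Prop :=
  ∀ i : Fin (D + 1), ∃ v : Polynomial ℝ, v.degree = (i : ℕ) ∧ ∀ j, O.Q j i = v.eval (O.Q j 1)

/-- The Krein array is `{b 0, …, b (D-1); c 0, …, c (D-1)}`, that is, `b*_i = q_{1,i+1}^i = b i` and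
`c*_{i+1} = q_{1,i}^{i+1} = c i` for `0 ≤ i < D`. -/
def HasKreinArray (O : S.IdempotentOrdering) (b c : Fin D → ℝ) : Prop :=
  ∀ i : Fin D, O.krein 1 i.succ i.castSucc = b i ∧ O.krein 1 i.castSucc i.succ = c i

/-- The relations are in their natural ordering: `Q_{01} > Q_{11} > … > Q_{D1}`. -/
def IsNatural (O : S.IdempotentOrdering) : Prop :=
  StrictAnti fun j : Fin (D + 1) => O.Q j 1

end IdempotentOrdering

end AssociationScheme

end

/-! Normalized to have unit diagonal, `E₁` is the Gram matrix `U` of unit vectors. The Krein array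
forces `|X| = 2m²`, entries `±1`, `±1/s`, `0` with `s = |r|`, and an antipode for every vector.
Since `E₁² = E₁`, `U² = 2m U`; since `q₁₁¹ = q₁₁³ = q₁₁⁴ = 0`, `U ∘ U` lies in the span of `J` and
`E₂`, so the sums `∑ U x w ² U y w ²` are affine in `U x y ²`.

These two moment identities imply a third, for `∑ U y w ² U x w U z w` over arbitrary triples
(`sum_sq_mul_mul`): the defect is a matrix whose Frobenius norm is a quadratic form in `U ∘ U`, and
that form vanishes. Take `x` with inner product `1/s` to two orthogonal vectors `y`, `z`, and add
the instances based at `y` and at `x`. Vectors whose inner products with `x` and `y` have opposite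
signs cancel, and the antipodal symmetry leaves a single relation between `[1 1 3]` and `[1 1 1]`
(`count_sub_count`), which is (ii). Such a triple always exists (`exists_triple`), the counts are
integers and `s²(1 - s)` is even, so `m` is even, which is (i). -/

open scoped Matrix

noncomputable section

/-! ### Moment identities and triple counts for a Gram matrix -/

section LineSystem

variable {X : Type*} [Fintype X]

/-- For fixed `y`, let `Δ` be the diagonal matrix of the squares `U y w ²`, corrected at `y` and by
a multiple of the identity. The claim is `U Δ U = 0`. By `hU`, its squared Frobenius norm is `c²`
times the value of the quadratic form `U ∘ U` at the diagonal of `Δ`, and `hH` says that `U ∘ U`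
kills this diagonal. -/
theorem sum_sq_mul_mul [DecidableEq X] {U : Matrix X X ℝ} {c α β : ℝ} (hc : c ≠ 0)
    (hsymm : ∀ x y, U x y = U y x) (hdiag : ∀ x, U x x = 1)
    (hU : ∀ x y, ∑ w, U x w * U y w = c * U x y)
    (hH : ∀ x y, ∑ w, U x w ^ 2 * U y w ^ 2 = α * U x y ^ 2 + β) (x y z : X) :
    ∑ w, U y w ^ 2 * (U x w * U z w) = α * (U x y * U z y) + β * U x z := by
  let M : X → X → ℝ := fun y w => U y w ^ 2 - α * (if y = w then 1 else 0) - β / c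
  have hM : ∀ x y z, ∑ w, M y w * (U x w * U z w) =
      ∑ w, U y w ^ 2 * (U x w * U z w) - α * (U x y * U z y) - β * U x z := by
    intro x y z
    simp only [M, sub_mul, Finset.sum_sub_distrib, mul_assoc, ← Finset.mul_sum, hU]
    simp only [ite_mul, one_mul, zero_mul, Finset.sum_ite_eq, Finset.mem_univ, if_true]
    field_simp
  -- This is the diagonal case `x = z = v` of the claim, where `hH` applies directly.
  have hMH : ∀ y v, ∑ w, M y w * U v w ^ 2 = 0 := by
    intro y v
    simp only [sq (U v _), hM, hdiag]
    simp only [← sq, hH, hsymm v y]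
    ring
  have key : ∑ y, ∑ x, ∑ z, (∑ w, M y w * (U x w * U z w)) ^ 2 = 0 := by
    refine Finset.sum_eq_zero fun y _ => ?_
    calc ∑ x, ∑ z, (∑ w, M y w * (U x w * U z w)) ^ 2
        = ∑ x, ∑ z, ∑ w, ∑ v, M y w * M y v * (U w x * U v x) * (U w z * U v z) := by
          refine Finset.sum_congr rfl fun x _ => Finset.sum_congr rfl fun z _ => ?_
          rw [sq, Finset.sum_mul_sum]
          refine Finset.sum_congr rfl fun w _ => Finset.sum_congr rfl fun v _ => ?_
          rw [hsymm x w, hsymm z w, hsymm x v, hsymm z v]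
          ring
      _ = ∑ x, ∑ w, ∑ v, ∑ z, M y w * M y v * (U w x * U v x) * (U w z * U v z) := by
          refine Finset.sum_congr rfl fun x _ => ?_
          rw [Finset.sum_comm]
          refine Finset.sum_congr rfl fun w _ => ?_
          rw [Finset.sum_comm]
      _ = ∑ w, ∑ v, ∑ x, ∑ z, M y w * M y v * (U w x * U v x) * (U w z * U v z) := by
          rw [Finset.sum_comm]
          refine Finset.sum_congr rfl fun w _ => ?_
          rw [Finset.sum_comm]
      _ = ∑ w, c ^ 2 * (M y w * ∑ v, M y v * U w v ^ 2) := by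
          refine Finset.sum_congr rfl fun w _ => ?_
          rw [Finset.mul_sum, Finset.mul_sum]
          refine Finset.sum_congr rfl fun v _ => ?_
          simp only [← Finset.mul_sum, hU, ← Finset.sum_mul]
          ring
      _ = 0 := by simp [hMH]
  have h1 := (Finset.sum_eq_zero_iff_of_nonneg fun y _ => by positivity).1 key y
    (Finset.mem_univ _)
  have h2 := (Finset.sum_eq_zero_iff_of_nonneg fun x _ => by positivity).1 h1 x
    (Finset.mem_univ _)
  have h3 := (Finset.sum_eq_zero_iff_of_nonneg fun z _ => sq_nonneg _).1 h2 z (Finset.mem_univ _)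
  have h4 := pow_eq_zero_iff (two_ne_zero) |>.1 h3
  rw [hM] at h4
  linarith

/-- The Gram matrix of a system of unit vectors, closed under negation, whose inner products are
`0`, `±1` and `±1 / s`, with the moment identities of the Latin square type schemes. -/
structure LatinGram (U : Matrix X X ℝ) (m s : ℝ) : Prop where
  m_ne : m ≠ 0
  one_lt : 1 < s
  symm : ∀ x y, U x y = U y x
  diag : ∀ x, U x x = 1
  values : ∀ x y, U x y = 1 ∨ U x y = 1 / s ∨ U x y = 0 ∨ U x y = -(1 / s) ∨ U x y = -1
  eq_of_eq_one : ∀ x y, U x y = 1 → x = y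
  exists_neg : ∀ x, ∃ y, U x y = -1
  exists_zero : ∃ x y, U x y = 0
  sum_mul : ∀ x y, ∑ w, U x w * U y w = 2 * m * U x y
  sum_sq_mul_sq : ∀ x y, ∑ w, U x w ^ 2 * U y w ^ 2 =
    2 * m / s ^ 2 * U x y ^ 2 + 2 * (s ^ 2 - 1) / s ^ 2

namespace LatinGram

variable {U : Matrix X X ℝ} {m s : ℝ}

/-- Unit vectors with inner product `-1` are opposite: the squared norm of the sum of the two rows
is `2m(1 - 2 + 1) = 0`. -/
theorem neg_row (h : LatinGram U m s) {x y : X} (hxy : U x y = -1) (w : X) :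
    U y w = -U x w := by
  have h1 : ∑ w, (U x w + U y w) ^ 2 = 0 := by
    have : ∀ w, (U x w + U y w) ^ 2 =
        U x w * U x w + 2 * (U x w * U y w) + U y w * U y w := fun w => by ring
    simp only [this, Finset.sum_add_distrib, ← Finset.mul_sum, h.sum_mul, h.diag, hxy]
    ring
  have h2 := (Finset.sum_eq_zero_iff_of_nonneg fun w _ => sq_nonneg _).1 h1 w (Finset.mem_univ _)
  have h3 := pow_eq_zero_iff (two_ne_zero) |>.1 h2
  linarith

theorem exists_antipode (h : LatinGram U m s) :
    ∃ σ : Equiv.Perm X, (∀ x w, U (σ x) w = -U x w) ∧ ∀ x y, U x y = -1 → y = σ x := by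
  choose f hf using h.exists_neg
  have hrow : ∀ x w, U (f x) w = -U x w := fun x w => h.neg_row (hf x) w
  have hinv : Function.Involutive f := fun x => by
    apply h.eq_of_eq_one
    rw [hrow, hrow, h.diag, neg_neg]
  refine ⟨hinv.toPerm, hrow, fun x y hxy => ?_⟩
  refine (h.eq_of_eq_one _ _ ?_).symm
  change U (f x) y = 1
  rw [hrow, hxy, neg_neg]

/-- The number of `w` with prescribed inner products `a`, `b`, `c` with `x`, `y`, `z`. -/
def count (U : Matrix X X ℝ) (x y z : X) (a b c : ℝ) : ℕ :=
  {w : X | U x w = a ∧ U y w = b ∧ U z w = c}.ncard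

theorem count_eq_sum (x y z : X) (a b c : ℝ) : (count U x y z a b c : ℝ) =
    ∑ w, if U x w = a ∧ U y w = b ∧ U z w = c then (1 : ℝ) else 0 := by
  classical
  rw [count, Set.ncard_eq_toFinset_card', Finset.sum_boole]
  congr 2
  ext w
  simp

theorem count_neg (h : LatinGram U m s) (x y z : X) (a b c : ℝ) :
    count U x y z (-a) (-b) (-c) = count U x y z a b c := by
  obtain ⟨σ, hσ, -⟩ := h.exists_antipode
  have hσ' : ∀ x w, U x (σ w) = -U x w := fun x w => by rw [h.symm, hσ, h.symm]
  have : (count U x y z (-a) (-b) (-c) : ℝ) = count U x y z a b c := by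
    rw [count_eq_sum, count_eq_sum, ← Equiv.sum_comp σ]
    simp only [hσ', neg_inj]
  exact_mod_cast this

/-- The two products cancel when `U x w` and `U y w` have opposite signs, and otherwise add up to
`±2t⁴` if all three inner products are `±t`. The points `±y`, `±z` contribute nothing because `y`
and `z` are orthogonal; only `±x` need a correction, `t³ + t²` each. -/
theorem weight_eq [DecidableEq X] (h : LatinGram U m s) {σ : X → X}
    (hσ : ∀ x w, U (σ x) w = -U x w) (hσ' : ∀ x y, U x y = -1 → y = σ x) {x y z : X} {t : ℝ}
    (hts : t = 1 / s) (hxy : U x y = t) (hxz : U x z = t) (hyz : U y z = 0) (w : X) :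
    U y w ^ 2 * (U x w * U z w) + U x w ^ 2 * (U y w * U z w) =
      2 * t ^ 4 * ((if U x w = t ∧ U y w = t ∧ U z w = t then (1 : ℝ) else 0)
        + (if U x w = -t ∧ U y w = -t ∧ U z w = -t then (1 : ℝ) else 0)
        - (if U x w = t ∧ U y w = t ∧ U z w = -t then (1 : ℝ) else 0)
        - (if U x w = -t ∧ U y w = -t ∧ U z w = -(-t) then (1 : ℝ) else 0))
      + (1 + t) * t ^ 2 *
        ((if w = x then (1 : ℝ) else 0) + if w = σ x then (1 : ℝ) else 0) := by
  have hs := h.one_lt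
  have hs0 : 0 < s := by linarith
  have ht : 0 < t := by rw [hts]; positivity
  have ht1 : t < 1 := by rw [hts, div_lt_one hs0]; exact hs
  have hv := h.values
  rw [← hts] at hv
  have n1 : (1 : ℝ) ≠ t := by linarith
  have n2 : (1 : ℝ) ≠ -t := by linarith
  have n3 : (-1 : ℝ) ≠ t := by linarith
  have n4 : t ≠ -t := by linarith
  have n5 : -t ≠ t := by linarith
  have n6 : (0 : ℝ) ≠ t := by linarith
  have n7 : t ≠ 0 := by linarith
  have hneg : U x (σ x) = -1 := by rw [h.symm, hσ, h.diag]
  have hxσ : x ≠ σ x := fun e => by rw [← e, h.diag] at hneg; norm_num at hneg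
  by_cases hw1 : w = x
  · subst hw1
    simp [h.diag, h.symm y w, hxy, h.symm z w, hxz, n1, n2, hxσ]
    ring
  by_cases hw2 : w = σ x
  · subst hw2
    simp [hneg, h.symm y (σ x), h.symm z (σ x), hσ, hxy, hxz, n1, n3, hxσ.symm]
    ring
  have hx1 : U x w ≠ 1 := fun e => hw1 (h.eq_of_eq_one _ _ e).symm
  have hx2 : U x w ≠ -1 := fun e => hw2 (hσ' _ _ e)
  have hzy : U z y = 0 := by rw [h.symm, hyz]
  have hyw : U y w = 1 ∨ U y w = -1 → U z w = 0 := by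
    rintro (e | e)
    · rw [← h.eq_of_eq_one _ _ e, hzy]
    · rw [h.symm, h.neg_row e, hyz, neg_zero]
  have hzw : U z w = 1 ∨ U z w = -1 → U y w = 0 := by
    rintro (e | e)
    · rw [← h.eq_of_eq_one _ _ e, hyz]
    · rw [h.symm, h.neg_row e, hzy, neg_zero]
  simp only [hw1, hw2, if_false, add_zero, mul_zero, neg_neg]
  by_cases hy0 : U y w = 0
  · simp [hy0, n6, n7]
  by_cases hz0 : U z w = 0
  · simp [hz0, n6, n7]
  have hy3 : U y w = t ∨ U y w = -t := by
    rcases hv y w with e | e | e | e | e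
    exacts [absurd (hyw (Or.inl e)) hz0, Or.inl e, absurd e hy0, Or.inr e,
      absurd (hyw (Or.inr e)) hz0]
  have hz3 : U z w = t ∨ U z w = -t := by
    rcases hv z w with e | e | e | e | e
    exacts [absurd (hzw (Or.inl e)) hy0, Or.inl e, absurd e hz0, Or.inr e,
      absurd (hzw (Or.inr e)) hy0]
  have hx3 : U x w = t ∨ U x w = 0 ∨ U x w = -t := by
    rcases hv x w with e | e | e | e | e
    exacts [absurd e hx1, Or.inl e, Or.inr (Or.inl e), Or.inr (Or.inr e), absurd e hx2]
  rcases hx3 with e1 | e1 | e1 <;> rcases hy3 with e2 | e2 <;> rcases hz3 with e3 | e3 <;>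
    simp only [e1, e2, e3, n4, n5, n6, n7, zero_eq_neg, and_self, and_true,
      and_false, if_true, if_false] <;> ring

theorem count_sub_count [DecidableEq X] (h : LatinGram U m s) {x y z : X} (hxy : U x y = 1 / s)
    (hxz : U x z = 1 / s) (hyz : U y z = 0) :
    (count U x y z (1 / s) (1 / s) (-(1 / s)) : ℝ) =
      s + s ^ 2 * (1 - s) / 2 - m / 2 + count U x y z (1 / s) (1 / s) (1 / s) := by
  have hs0 : s ≠ 0 := by linarith [h.one_lt]
  obtain ⟨σ, hσ, hσ'⟩ := h.exists_antipode
  have hm2 : 2 * m ≠ 0 := mul_ne_zero two_ne_zero h.m_ne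
  -- The squared factor sits at `y` here and at `x` in the next instance; `weight_eq` evaluates the
  -- sum of the two.
  have e1 := sum_sq_mul_mul hm2 h.symm h.diag h.sum_mul h.sum_sq_mul_sq x y z
  have e2 := sum_sq_mul_mul hm2 h.symm h.diag h.sum_mul h.sum_sq_mul_sq y x z
  rw [hxy, hxz, h.symm z y, hyz] at e1
  rw [h.symm y x, hxy, h.symm z x, hxz, hyz] at e2
  have tot := Finset.sum_congr (rfl : (Finset.univ : Finset X) = _) fun w _ =>
    h.weight_eq hσ hσ' rfl hxy hxz hyz w
  simp only [Finset.sum_add_distrib, ← Finset.mul_sum, Finset.sum_sub_distrib,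
    ← count_eq_sum, h.count_neg, e1, e2, Finset.sum_ite_eq', Finset.mem_univ, if_true] at tot
  generalize (count U x y z (1 / s) (1 / s) (-(1 / s)) : ℝ) = a at *
  generalize (count U x y z (1 / s) (1 / s) (1 / s) : ℝ) = b at *
  field_simp at tot ⊢
  linarith

theorem exists_triple (h : LatinGram U m s) :
    ∃ x y z, U x y = 1 / s ∧ U x z = 1 / s ∧ U y z = 0 := by
  obtain ⟨y, z, hyz⟩ := h.exists_zero
  have hs := h.one_lt
  obtain ⟨σ, hσ, -⟩ := h.exists_antipode
  -- For orthogonal `y`, `z` the sum equals `2(s² - 1)/s² > 0`, so some `x` is orthogonal to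
  -- neither. It differs from `±y` and `±z`, and replacing `y`, `z` by antipodes makes both inner
  -- products positive.
  have hpos : ∑ w, U y w ^ 2 * U z w ^ 2 ≠ 0 := by
    rw [h.sum_sq_mul_sq, hyz]
    have : 0 < s ^ 2 - 1 := by nlinarith
    have hs0 : 0 < s := by linarith
    simp only [ne_eq, OfNat.ofNat_ne_zero, not_false_eq_true, zero_pow, mul_zero, zero_add]
    positivity
  obtain ⟨x, -, hx⟩ := Finset.exists_ne_zero_of_sum_ne_zero hpos
  have hzy : U z y = 0 := by rw [h.symm, hyz]
  have hne : ∀ y z, U y z = 0 → U z x ≠ 0 → ∃ y', (∀ w, U y' w = U y w ∨ U y' w = -U y w) ∧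
      (U y x ≠ 0 → U y' x = 1 / s) := by
    intro y z hyz hzx
    rcases h.values y x with h1 | h1 | h1 | h1 | h1
    · rw [h.eq_of_eq_one _ _ h1, h.symm] at hyz
      exact absurd hyz hzx
    · exact ⟨y, fun w => Or.inl rfl, fun _ => h1⟩
    · exact ⟨y, fun w => Or.inl rfl, fun h2 => absurd h1 h2⟩
    · exact ⟨σ y, fun w => Or.inr (hσ y w), fun _ => by rw [hσ, h1, neg_neg]⟩
    · rw [h.symm, h.neg_row h1, hyz] at hzx
      simp at hzx
  have hyx : U y x ≠ 0 := fun h0 => hx (by simp [h0])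
  have hzx : U z x ≠ 0 := fun h0 => hx (by simp [h0])
  obtain ⟨y', hy', hy1⟩ := hne y z hyz hzx
  obtain ⟨z', hz', hz1⟩ := hne z y hzy hyx
  refine ⟨x, y', z', by rw [h.symm, hy1 hyx], by rw [h.symm, hz1 hzx], ?_⟩
  have h1 : U y z' = 0 := by rw [h.symm]; rcases hz' y with h2 | h2 <;> simp [h2, hzy]
  rcases hy' z' with h2 | h2 <;> simp [h2, h1]

end LatinGram

end LineSystem

/-! ### General facts on symmetric schemes, idempotents and Krein parameters -/

namespace AssociationScheme

variable {X : Type*} [Fintype X] [DecidableEq X] {D : ℕ}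

theorem exists_mem (S : AssociationScheme X D) (x y : X) : ∃ j, (x, y) ∈ S.R j := by
  by_contra! h
  have h1 := S.sum_A_apply x y
  simp [fun j => S.A_apply_of_notMem (h j)] at h1

theorem mem_symm (S : AssociationScheme X D) {j : Fin (D + 1)} {x y : X} (h : (x, y) ∈ S.R j) :
    (y, x) ∈ S.R j := by
  by_contra h1
  have h2 := congrFun (congrFun (S.adj_symm j) x) y
  rw [Matrix.transpose_apply] at h2
  change S.A j y x = S.A j x y at h2
  rw [S.A_apply_of_mem h, S.A_apply_of_notMem h1] at h2
  norm_num at h2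

theorem diag_mem (S : AssociationScheme X D) (x : X) : (x, x) ∈ S.R 0 := by
  by_contra h
  have h1 := S.A_apply_of_notMem h
  rw [A, S.adj_zero] at h1
  simp at h1

theorem eq_of_mem_zero (S : AssociationScheme X D) {x y : X} (h : (x, y) ∈ S.R 0) : x = y := by
  by_contra hne
  have h1 := S.A_apply_of_mem h
  rw [A, S.adj_zero, Matrix.one_apply_ne hne] at h1
  norm_num at h1

/-- Every vertex has a neighbour in every relation. -/
theorem exists_neighbor (S : AssociationScheme X D) (j : Fin (D + 1)) (x : X) :
    ∃ y, (x, y) ∈ S.R j := by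
  obtain ⟨p, hp⟩ := S.adj_mul j j
  -- The diagonal of `A_j²` is constant: `p 0` is the valency of `R_j`.
  have hval : ∀ v, ∑ w, S.A j v w * S.A j w v = p 0 := by
    intro v
    have h1 := congrFun (congrFun hp v) v
    rw [Matrix.mul_apply, Matrix.sum_apply,
      Finset.sum_eq_single (0 : Fin (D + 1))] at h1
    · simpa [S.adj_zero, A] using h1
    · intro k _ hk
      have : (v, v) ∉ S.R k := fun h => hk (S.eq_of_mem h (S.diag_mem v))
      have h2 := S.A_apply_of_notMem this
      rw [A] at h2
      simp [h2]
    · simp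
  obtain ⟨⟨u, v⟩, huv⟩ := S.nonempty j
  by_contra! hno
  have h0 : (p 0 : ℝ) = 0 := by
    rw [← hval x]
    exact Finset.sum_eq_zero fun w _ => by rw [S.A_apply_of_notMem (hno w), zero_mul]
  have h1 := hval u
  rw [h0, Finset.sum_eq_zero_iff_of_nonneg
    fun w _ => mul_nonneg (S.A_nonneg _ _ _) (S.A_nonneg _ _ _)] at h1
  have h2 := h1 v (Finset.mem_univ _)
  rw [S.A_apply_of_mem huv, S.A_apply_of_mem (S.mem_symm huv)] at h2
  norm_num at h2

namespace IdempotentOrdering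

variable {S : AssociationScheme X D} (O : S.IdempotentOrdering)

theorem E_apply (i : Fin (D + 1)) {j : Fin (D + 1)} {x y : X} (h : (x, y) ∈ S.R j) :
    O.E i x y = O.Q j i / Fintype.card X := by
  rw [O.E_eq_sum, Matrix.smul_apply, Matrix.sum_apply, Finset.sum_eq_single j]
  · simp [S.A_apply_of_mem h, div_eq_inv_mul]
  · intro k _ hk
    have : (x, y) ∉ S.R k := fun h' => hk (S.eq_of_mem h' h)
    simp [S.A_apply_of_notMem this]
  · simp

theorem E_symm (i : Fin (D + 1)) (x y : X) : O.E i x y = O.E i y x := by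
  obtain ⟨j, hj⟩ := S.exists_mem x y
  rw [O.E_apply i hj, O.E_apply i (S.mem_symm hj)]

theorem E_diag (i : Fin (D + 1)) (x : X) : O.E i x x = O.Q 0 i / Fintype.card X :=
  O.E_apply i (S.diag_mem x)

theorem E_zero_apply (x y : X) : O.E 0 x y = 1 / Fintype.card X := by
  rw [E, O.basis_zero, Matrix.of_apply]

theorem Q_zero_right (j : Fin (D + 1)) : O.Q j 0 = 1 := by
  obtain ⟨⟨x, y⟩, h⟩ := S.nonempty j
  have h1 := O.E_apply 0 h
  rw [O.E_zero_apply, div_left_inj' O.card_ne_zero] at h1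
  exact h1.symm

theorem E_ne_zero (i : Fin (D + 1)) : O.E i ≠ 0 := fun h =>
  O.basis.ne_zero i (Subtype.ext h)

theorem sum_E_mul_E (i j : Fin (D + 1)) (x y : X) :
    ∑ w, O.E i x w * O.E j w y = if i = j then O.E i x y else 0 := by
  have h := congrFun (congrFun (O.mul_eq i j) x) y
  rw [Matrix.mul_apply] at h
  rw [E, E, h]
  split_ifs <;> simp

theorem sum_sum_E_mul_E (i j : Fin (D + 1)) :
    ∑ x, ∑ y, O.E i x y * O.E j x y = if i = j then O.Q 0 i else 0 := by
  have h : ∀ x, ∑ y, O.E i x y * O.E j x y = if i = j then O.E i x x else 0 := fun x => by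
    simp only [← O.sum_E_mul_E, O.E_symm j x]
  simp only [h, O.E_diag]
  split_ifs
  · simp [mul_div_cancel₀ _ O.card_ne_zero]
  · simp

theorem Q_zero_pos (i : Fin (D + 1)) : 0 < O.Q 0 i := by
  have h := O.sum_sum_E_mul_E i i
  rw [if_pos rfl] at h
  rw [← h]
  simp only [← sq]
  refine lt_of_le_of_ne (by positivity) fun h0 => O.E_ne_zero i ?_
  ext x y
  have h1 := (Finset.sum_eq_zero_iff_of_nonneg fun x _ => by positivity).1 h0.symm x
    (Finset.mem_univ _)
  have h2 := (Finset.sum_eq_zero_iff_of_nonneg fun y _ => by positivity).1 h1 y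
    (Finset.mem_univ _)
  simpa using h2

theorem mem_boseMesner_eq_sum {M : Matrix X X ℝ} (hM : M ∈ S.boseMesner) :
    ∃ c : Fin (D + 1) → ℝ, M = ∑ i, c i • O.E i := by
  have h := congrArg (Subtype.val : S.boseMesner → Matrix X X ℝ) (O.basis.sum_repr ⟨M, hM⟩)
  simp only [Submodule.coe_sum, Submodule.coe_smul] at h
  exact ⟨_, h.symm⟩

theorem A_mem (i : Fin (D + 1)) : S.A i ∈ S.boseMesner := Submodule.subset_span ⟨i, rfl⟩

/-- The identity `A₀` is some combination of the `E_i`; multiplying by `E_i` shows that its `i`-th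
term is `E_i` itself. -/
theorem sum_E_apply (x y : X) : ∑ i, O.E i x y = if x = y then 1 else 0 := by
  obtain ⟨c, hc⟩ := O.mem_boseMesner_eq_sum (A_mem (S := S) 0)
  rw [A, S.adj_zero] at hc
  have hE : ∀ i, O.E i = c i • O.E i := by
    intro i
    have h1 : O.E i = O.E i * ∑ j, c j • O.E j := by rw [← hc, mul_one]
    rw [Matrix.mul_sum, Finset.sum_eq_single i] at h1
    · rw [Matrix.mul_smul] at h1
      have h2 := O.mul_eq i i
      rw [if_pos rfl] at h2
      rwa [E, h2] at h1
    · intro j _ hj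
      have h2 := O.mul_eq i j
      rw [if_neg hj.symm] at h2
      rw [Matrix.mul_smul, E, E, h2, smul_zero]
    · simp
  simp only [← hE] at hc
  rw [← Matrix.one_apply, hc, Matrix.sum_apply]

theorem sum_Q_zero : ∑ i, O.Q 0 i = Fintype.card X := by
  obtain ⟨⟨x, _⟩, _⟩ := S.nonempty 0
  have h := O.sum_E_apply x x
  simp only [O.E_diag, ← Finset.sum_div, if_true] at h
  rwa [div_eq_one_iff_eq O.card_ne_zero] at h

theorem E_mul_E_apply (i j : Fin (D + 1)) (x y : X) :
    O.E i x y * O.E j x y = (∑ k, O.krein i j k * O.E k x y) / Fintype.card X := by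
  have h := congrFun (congrFun (O.E_hadamard_E i j) x) y
  rw [Matrix.hadamard_apply, Matrix.smul_apply, Matrix.sum_apply] at h
  rw [h, div_eq_inv_mul]
  simp

theorem Q_mul_Q (j i k : Fin (D + 1)) : O.Q j i * O.Q j k = ∑ l, O.krein i k l * O.Q j l := by
  obtain ⟨⟨x, y⟩, hxy⟩ := S.nonempty j
  have h := O.E_mul_E_apply i k x y
  simp only [O.E_apply _ hxy] at h
  have hn := O.card_ne_zero
  simp only [mul_div_assoc', ← Finset.sum_div] at h
  field_simp at h
  exact h

theorem sum_sum_E_mul_E_mul_E (i j k : Fin (D + 1)) :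
    ∑ x, ∑ y, O.E i x y * O.E j x y * O.E k x y =
      O.krein i j k * O.Q 0 k / Fintype.card X := by
  simp only [O.E_mul_E_apply, div_mul_eq_mul_div, Finset.sum_mul, ← Finset.sum_div]
  congr 1
  calc ∑ x, ∑ y, ∑ l, O.krein i j l * O.E l x y * O.E k x y
      = ∑ l, O.krein i j l * ∑ x, ∑ y, O.E l x y * O.E k x y := by
        simp only [Finset.mul_sum, ← mul_assoc]
        rw [Finset.sum_comm]
        conv_rhs => rw [Finset.sum_comm]
        rw [Finset.sum_comm]
        refine Finset.sum_congr rfl fun x _ => ?_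
        rw [Finset.sum_comm]
    _ = O.krein i j k * O.Q 0 k := by
        simp [O.sum_sum_E_mul_E]

/-- Both sides are, up to the factor `|X|`, the entry sum of `E_i ∘ E_j ∘ E_k`, which is symmetric
in the indices. -/
theorem krein_mul_Q_zero (i j k : Fin (D + 1)) :
    O.krein i j k * O.Q 0 k = O.krein i k j * O.Q 0 j := by
  have h1 := O.sum_sum_E_mul_E_mul_E i j k
  have h2 := O.sum_sum_E_mul_E_mul_E i k j
  simp only [mul_right_comm _ (O.E k _ _) (O.E j _ _)] at h2
  rw [h1, div_left_inj' O.card_ne_zero] at h2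
  exact h2

theorem krein_eq_zero_comm {i j k : Fin (D + 1)} (h : O.krein i j k = 0) :
    O.krein i k j = 0 := by
  have h1 := O.krein_mul_Q_zero i j k
  rw [h, zero_mul] at h1
  exact (mul_eq_zero.1 h1.symm).resolve_right (O.Q_zero_pos j).ne'

theorem sum_krein (i k : Fin (D + 1)) : ∑ j, O.krein i j k = O.Q 0 i := by
  have h : ∑ j, O.krein i j k * O.Q 0 k / Fintype.card X =
      O.Q 0 i * O.Q 0 k / Fintype.card X := by
    simp only [← O.sum_sum_E_mul_E_mul_E]
    calc ∑ j, ∑ x, ∑ y, O.E i x y * O.E j x y * O.E k x y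
        = ∑ x, ∑ y, O.E i x y * O.E k x y * ∑ j, O.E j x y := by
          rw [Finset.sum_comm]
          refine Finset.sum_congr rfl fun x _ => ?_
          rw [Finset.sum_comm]
          refine Finset.sum_congr rfl fun y _ => ?_
          rw [Finset.mul_sum]
          exact Finset.sum_congr rfl fun j _ => by ring
      _ = O.Q 0 i * O.Q 0 k / Fintype.card X := by
          simp only [O.sum_E_apply, mul_ite, mul_one, mul_zero, Finset.sum_ite_eq,
            Finset.mem_univ, if_true, O.E_diag, Finset.sum_const, Finset.card_univ, nsmul_eq_mul]
          have := O.card_ne_zero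
          field_simp
  rw [← Finset.sum_div, div_left_inj' O.card_ne_zero, ← Finset.sum_mul] at h
  exact mul_right_cancel₀ (O.Q_zero_pos k).ne' h

theorem krein_zero_zero {i : Fin (D + 1)} (hi : i ≠ 0) : O.krein i 0 0 = 0 := by
  have h := O.sum_sum_E_mul_E_mul_E i 0 0
  have h2 := O.sum_sum_E_mul_E i 0
  rw [if_neg hi] at h2
  simp only [O.E_zero_apply, ← Finset.sum_mul] at h h2
  rw [h2, zero_mul, O.Q_zero_right, mul_one, eq_comm, div_eq_zero_iff] at h
  exact h.resolve_right O.card_ne_zero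

variable {O}

/-- If `Q_{j1} = Q_{k1}`, then rows `j` and `k` of `Q` agree, so every combination of the
idempotents takes the same value on `R_j` and `R_k`; but `A_j` does not. -/
theorem IsQPolynomial.Q_one_injective (hO : O.IsQPolynomial) :
    Function.Injective fun j => O.Q j 1 := by
  intro j k hjk
  by_contra hne
  have hQ : ∀ i, O.Q j i = O.Q k i := by
    intro i
    obtain ⟨v, -, hv⟩ := hO i
    rw [hv, hv]
    exact congrArg (fun t => v.eval t) hjk
  obtain ⟨c, hc⟩ := O.mem_boseMesner_eq_sum (A_mem (S := S) j)
  obtain ⟨⟨x, y⟩, hxy⟩ := S.nonempty j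
  obtain ⟨⟨u, v⟩, huv⟩ := S.nonempty k
  have h1 := congrFun (congrFun hc x) y
  have h2 := congrFun (congrFun hc u) v
  have huv' : (u, v) ∉ S.R j := fun h => hne (S.eq_of_mem h huv)
  rw [S.A_apply_of_mem hxy, Matrix.sum_apply] at h1
  rw [S.A_apply_of_notMem huv', Matrix.sum_apply] at h2
  simp only [Matrix.smul_apply, O.E_apply _ hxy, O.E_apply _ huv, hQ] at h1 h2
  rw [← h2] at h1
  norm_num at h1

end IdempotentOrdering
end AssociationScheme

open Polynomial in
theorem Polynomial.coeff_sum_smul_of_degree_eq {n : ℕ} {v : Fin n → ℝ[X]}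
    (hv : ∀ k, (v k).degree = (k : ℕ)) {c : Fin n → ℝ} {k : Fin n} (hc : ∀ l, k < l → c l = 0) :
    (∑ l, c l • v l).coeff k = c k * (v k).leadingCoeff := by
  rw [Polynomial.finsetSum_coeff, Finset.sum_eq_single k]
  · rw [coeff_smul, smul_eq_mul, leadingCoeff, natDegree_eq_of_degree_eq_some (hv k)]
  · intro l _ hl
    rcases lt_or_gt_of_ne hl with h | h
    · rw [coeff_smul, coeff_eq_zero_of_degree_lt, smul_zero]
      rw [hv]
      exact_mod_cast h
    · rw [hc l h, zero_smul, coeff_zero]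
  · simp

/-! ### Vanishing of Krein parameters from the `Q`-polynomial property -/

namespace AssociationScheme
namespace IdempotentOrdering
variable {X : Type*} [Fintype X] [DecidableEq X] {D : ℕ}
  {S : AssociationScheme X D} {O : S.IdempotentOrdering}

open Polynomial in
-- The expansion of `Q_{j1} Q_{ji}` lifts to an identity of polynomials, `X v_i = ∑ q_{1i}^l v_l`,
-- and degrees can be compared.
theorem IsQPolynomial.krein_one (hO : O.IsQPolynomial) (i : Fin D) :
    (∀ k, i.succ < k → O.krein 1 i.castSucc k = 0) ∧ O.krein 1 i.castSucc i.succ ≠ 0 := by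
  choose v hdeg hv using hO
  have hX : (Polynomial.X * v i.castSucc).degree = ((i.succ : ℕ) : WithBot ℕ) := by
    rw [degree_mul, degree_X, hdeg]
    simp [add_comm]
  have hsum : Polynomial.X * v i.castSucc = ∑ l, O.krein 1 i.castSucc l • v l := by
    -- Both sides have degree at most `D` and agree at the `D + 1` distinct points `Q_{j1}`; this is
    -- where `i < D` is needed.
    refine Polynomial.eq_of_degrees_lt_of_eval_index_eq (s := Finset.univ)
      (v := fun j => O.Q j 1) 
      (Function.Injective.injOn (IsQPolynomial.Q_one_injective fun i => ⟨v i, hdeg i, hv i⟩))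
      ?_ ?_ ?_
    · rw [hX, Finset.card_univ, Fintype.card_fin]
      exact_mod_cast i.succ.isLt
    · rw [Finset.card_univ, Fintype.card_fin, ← mem_degreeLT]
      refine Submodule.sum_mem _ fun l _ => Submodule.smul_mem _ _ ?_
      rw [mem_degreeLT, hdeg]
      exact_mod_cast l.isLt
    · intro j _
      simp only [eval_mul, eval_X, eval_finsetSum, eval_smul, smul_eq_mul, ← hv]
      exact O.Q_mul_Q j 1 i.castSucc
  have hlead : ∀ k, (v k).leadingCoeff ≠ 0 := by
    intro k
    rw [leadingCoeff_ne_zero]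
    intro h0
    have h1 := hdeg k
    rw [h0, degree_zero] at h1
    exact absurd h1 (by simp)
  have hzero : ∀ k, i.succ < k → O.krein 1 i.castSucc k = 0 := by
    intro k
    induction k using WellFoundedGT.induction with
    | ind k ih =>
      intro hk
      have h1 := coeff_sum_smul_of_degree_eq hdeg (c := O.krein 1 i.castSucc) (k := k)
        fun l hl => ih l hl (hk.trans hl)
      rw [← hsum, coeff_eq_zero_of_degree_lt (by rw [hX]; exact_mod_cast hk)] at h1
      exact (mul_eq_zero.1 h1.symm).resolve_right (hlead k)
  refine ⟨hzero, fun h0 => ?_⟩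
  have h1 := coeff_sum_smul_of_degree_eq hdeg (c := O.krein 1 i.castSucc) hzero
  rw [← hsum, h0, zero_mul] at h1
  exact coeff_ne_zero_of_eq_degree hX h1

end IdempotentOrdering

end AssociationScheme

/-! ### The Krein array of Latin square type -/

namespace AssociationScheme

namespace IdempotentOrdering

variable {X : Type*} [Fintype X] [DecidableEq X] {S : AssociationScheme X 4}
  {O : S.IdempotentOrdering} {m q : ℝ}

/-- The Krein array of Latin square type, with `q` in place of `r ^ 2`. -/
def HasLatinKreinArray (O : S.IdempotentOrdering) (m q : ℝ) : Prop :=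
  O.HasKreinArray ![m, m - 1, m * (q - 1) / q, m - q + 1] ![1, m / q, q - 1, m]

theorem HasLatinKreinArray.Q_zero_one (hK : O.HasLatinKreinArray m q) (hO : O.IsQPolynomial) :
    O.Q 0 1 = m := by
  have h := O.sum_krein 1 0
  have h0 : O.krein 1 0 0 = 0 := O.krein_zero_zero (by decide)
  have h1 : O.krein 1 1 0 = m := (hK 0).1
  have h2 : O.krein 1 2 0 = 0 := O.krein_eq_zero_comm ((hO.krein_one 0).1 2 (by decide))
  have h3 : O.krein 1 3 0 = 0 := O.krein_eq_zero_comm ((hO.krein_one 0).1 3 (by decide))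
  have h4 : O.krein 1 4 0 = 0 := O.krein_eq_zero_comm ((hO.krein_one 0).1 4 (by decide))
  rw [Fin.sum_univ_five, h0, h1, h2, h3, h4] at h
  linarith

theorem HasLatinKreinArray.m_pos (hK : O.HasLatinKreinArray m q) (hO : O.IsQPolynomial) :
    0 < m := hK.Q_zero_one hO ▸ O.Q_zero_pos 1

/-- For `q = 0` the convention `m / 0 = 0` would give `c₂* = 0`, against the degree condition. -/
theorem HasLatinKreinArray.q_ne_zero (hK : O.HasLatinKreinArray m q) (hO : O.IsQPolynomial) :
    q ≠ 0 := by
  rintro rfl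
  have h : O.krein 1 1 2 = m / 0 := (hK 1).2
  rw [div_zero] at h
  exact (hO.krein_one 1).2 h

theorem HasLatinKreinArray.q_ne_one (hK : O.HasLatinKreinArray m q) (hO : O.IsQPolynomial) :
    q ≠ 1 := by
  rintro rfl
  have h : O.krein 1 2 3 = 1 - 1 := (hK 2).2
  rw [sub_self] at h
  exact (hO.krein_one 2).2 h

theorem HasLatinKreinArray.krein_one_one (hK : O.HasLatinKreinArray m q)
    (hO : O.IsQPolynomial) :
    O.krein 1 1 = ![m, 0, m / q, 0, 0] := by
  have h01 : O.krein 1 1 0 = m := (hK 0).1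
  have h10 : O.krein 1 0 1 = 1 := (hK 0).2
  have h21 : O.krein 1 2 1 = m - 1 := (hK 1).1
  have h12 : O.krein 1 1 2 = m / q := (hK 1).2
  have z13 : O.krein 1 1 3 = 0 := (hO.krein_one 1).1 3 (by decide)
  have z14 : O.krein 1 1 4 = 0 := (hO.krein_one 1).1 4 (by decide)
  have s := O.sum_krein 1 1
  rw [Fin.sum_univ_five, h10, h21, O.krein_eq_zero_comm z13, O.krein_eq_zero_comm z14,
    hK.Q_zero_one hO] at s
  -- The parameters `q_{1j}^1` sum over `j` to `m`, and the array entries already exhaust this sum;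
  -- the other diagonal parameters vanish likewise.
  have z11 : O.krein 1 1 1 = 0 := by linarith
  funext k
  fin_cases k
  exacts [h01, z11, h12, z13, z14]

theorem HasLatinKreinArray.krein_one_two (hK : O.HasLatinKreinArray m q)
    (hO : O.IsQPolynomial) :
    O.krein 1 2 = ![0, m - 1, 0, q - 1, 0] := by
  have h21 : O.krein 1 2 1 = m - 1 := (hK 1).1
  have h12 : O.krein 1 1 2 = m / q := (hK 1).2
  have h32 : O.krein 1 3 2 = m * (q - 1) / q := (hK 2).1
  have h23 : O.krein 1 2 3 = q - 1 := (hK 2).2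
  have z02 : O.krein 1 0 2 = 0 := (hO.krein_one 0).1 2 (by decide)
  have z24 : O.krein 1 2 4 = 0 := (hO.krein_one 2).1 4 (by decide)
  have s := O.sum_krein 1 2
  rw [Fin.sum_univ_five, z02, h12, h32, O.krein_eq_zero_comm z24, hK.Q_zero_one hO] at s
  have z22 : O.krein 1 2 2 = 0 := by
    have hq := hK.q_ne_zero hO
    field_simp at s
    linarith [(mul_eq_zero.1 (by linarith : q * O.krein 1 2 2 = 0)).resolve_left hq]
  funext k
  fin_cases k
  exacts [O.krein_eq_zero_comm z02, h21, z22, h23, z24]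

theorem HasLatinKreinArray.krein_one_three (hK : O.HasLatinKreinArray m q)
    (hO : O.IsQPolynomial) :
    O.krein 1 3 = ![0, 0, m * (q - 1) / q, 0, m] := by
  have h32 : O.krein 1 3 2 = m * (q - 1) / q := (hK 2).1
  have h23 : O.krein 1 2 3 = q - 1 := (hK 2).2
  have h43 : O.krein 1 4 3 = m - q + 1 := (hK 3).1
  have h34 : O.krein 1 3 4 = m := (hK 3).2
  have z03 : O.krein 1 0 3 = 0 := (hO.krein_one 0).1 3 (by decide)
  have z13 : O.krein 1 1 3 = 0 := (hO.krein_one 1).1 3 (by decide)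
  have s := O.sum_krein 1 3
  rw [Fin.sum_univ_five, z03, z13, h23, h43, hK.Q_zero_one hO] at s
  have z33 : O.krein 1 3 3 = 0 := by linarith
  funext k
  fin_cases k
  exacts [O.krein_eq_zero_comm z03, O.krein_eq_zero_comm z13, h32, z33, h34]

theorem HasLatinKreinArray.krein_one_four (hK : O.HasLatinKreinArray m q)
    (hO : O.IsQPolynomial) :
    O.krein 1 4 = ![0, 0, 0, m - q + 1, 0] := by
  have h43 : O.krein 1 4 3 = m - q + 1 := (hK 3).1
  have h34 : O.krein 1 3 4 = m := (hK 3).2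
  have z04 : O.krein 1 0 4 = 0 := (hO.krein_one 0).1 4 (by decide)
  have z14 : O.krein 1 1 4 = 0 := (hO.krein_one 1).1 4 (by decide)
  have z24 : O.krein 1 2 4 = 0 := (hO.krein_one 2).1 4 (by decide)
  have s := O.sum_krein 1 4
  rw [Fin.sum_univ_five, z04, z14, z24, h34, hK.Q_zero_one hO] at s
  have z44 : O.krein 1 4 4 = 0 := by linarith
  funext k
  fin_cases k
  exacts [O.krein_eq_zero_comm z04, O.krein_eq_zero_comm z14, O.krein_eq_zero_comm z24, h43, z44]

/-- The three-term recurrences for the dual eigenvalues. -/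
theorem HasLatinKreinArray.recurrence (hK : O.HasLatinKreinArray m q) (hO : O.IsQPolynomial)
    (j : Fin 5) :
    O.Q j 1 * O.Q j 1 = m + m / q * O.Q j 2 ∧
    O.Q j 1 * O.Q j 2 = (m - 1) * O.Q j 1 + (q - 1) * O.Q j 3 ∧
    O.Q j 1 * O.Q j 3 = m * (q - 1) / q * O.Q j 2 + m * O.Q j 4 ∧
    O.Q j 1 * O.Q j 4 = (m - q + 1) * O.Q j 3 := by
  refine ⟨?_, ?_, ?_, ?_⟩
  · rw [O.Q_mul_Q, hK.krein_one_one hO, Fin.sum_univ_five]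
    simp [O.Q_zero_right]
  · rw [O.Q_mul_Q, hK.krein_one_two hO, Fin.sum_univ_five]
    simp
  · rw [O.Q_mul_Q, hK.krein_one_three hO, Fin.sum_univ_five]
    simp
  · rw [O.Q_mul_Q, hK.krein_one_four hO, Fin.sum_univ_five]
    simp

/-- The recurrences at `j = 0` give the multiplicities `1`, `m`, `q(m - 1)`, `m(m - 1)`, `(m - 1)(m
- q + 1)`, in whose sum `q` cancels. -/
theorem HasLatinKreinArray.card_eq (hK : O.HasLatinKreinArray m q) (hO : O.IsQPolynomial) :
    (Fintype.card X : ℝ) = 2 * m ^ 2 := by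
  obtain ⟨h1, h2, h3, -⟩ := hK.recurrence hO 0
  have hm := (hK.m_pos hO).ne'
  have hq := hK.q_ne_zero hO
  have hq1 : q - 1 ≠ 0 := sub_ne_zero.2 (hK.q_ne_one hO)
  rw [← O.sum_Q_zero, Fin.sum_univ_five, O.Q_zero_right]
  rw [hK.Q_zero_one hO] at *
  have e2 : O.Q 0 2 = q * (m - 1) := by
    field_simp at h1
    linarith
  have e3 : O.Q 0 3 = m * (m - 1) := by
    rw [e2] at h2
    apply mul_left_cancel₀ hq1
    linarith
  have e4 : O.Q 0 4 = (m - 1) * (m - q + 1) := by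
    rw [e2, e3] at h3
    field_simp at h3
    linarith
  rw [e2, e3, e4]
  ring

theorem HasLatinKreinArray.values (hK : O.HasLatinKreinArray m q) (hO : O.IsQPolynomial)
    {s : ℝ} (hs : 0 < s) (hsq : s ^ 2 = q) (j : Fin 5) :
    O.Q j 1 / m = 1 ∨ O.Q j 1 / m = 1 / s ∨ O.Q j 1 / m = 0 ∨ O.Q j 1 / m = -(1 / s) ∨
      O.Q j 1 / m = -1 := by
  obtain ⟨h1, h2, h3, h4⟩ := hK.recurrence hO j
  have hm := (hK.m_pos hO).ne'
  have hq := hK.q_ne_zero hO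
  have hq1 : q - 1 ≠ 0 := sub_ne_zero.2 (hK.q_ne_one hO)
  obtain ⟨t, ht⟩ : ∃ t, O.Q j 1 = m * t := ⟨O.Q j 1 / m, by field_simp⟩
  rw [ht] at h1 h2 h3 h4 ⊢
  rw [mul_div_cancel_left₀ _ hm]
  have e2 : O.Q j 2 = q * (m * t ^ 2 - 1) := by
    field_simp at h1
    linarith
  have e3 : (q - 1) * O.Q j 3 = m * t * (q * (m * t ^ 2 - 1) - (m - 1)) := by
    rw [e2] at h2
    linarith
  have e4 : O.Q j 4 = t * O.Q j 3 - (q - 1) * (m * t ^ 2 - 1) := by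
    rw [e2] at h3
    field_simp at h3
    linarith
  rw [e4] at h4
  -- Eliminating `Q_{j2}`, `Q_{j3}`, `Q_{j4}` from the recurrences leaves a quintic in `t =
  -- Q_{j1}/m`, which factors completely once `q = s²`.
  have key : t * (t - 1) * (t + 1) * (s * t - 1) * (s * t + 1) = 0 := by
    subst hsq
    have : m ^ 3 * (t * (t - 1) * (t + 1) * (s * t - 1) * (s * t + 1)) = 0 := by
      linear_combination (s ^ 2 - 1) * h4 - (m * t ^ 2 - (m - s ^ 2 + 1)) * e3
    exact (mul_eq_zero.1 this).resolve_left (pow_ne_zero 3 hm)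
  simp only [mul_eq_zero, or_assoc] at key
  rcases key with h | h | h | h | h
  · exact Or.inr (Or.inr (Or.inl h))
  · exact Or.inl (by linarith)
  · exact Or.inr (Or.inr (Or.inr (Or.inr (by linarith))))
  · exact Or.inr (Or.inl (by field_simp; linarith))
  · exact Or.inr (Or.inr (Or.inr (Or.inl (by field_simp; linarith))))

/-- The normalized dual eigenvalues, in decreasing order. -/
def latinValues (s : ℝ) : Fin 5 → ℝ := ![1, 1 / s, 0, -(1 / s), -1]

theorem latinValues_strictAnti {s : ℝ} (hs : 1 < s) : StrictAnti (latinValues s) := by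
  have h0 : 0 < 1 / s := by positivity
  have h1 : 1 / s < 1 := by rw [div_lt_one (by linarith)]; exact hs
  rw [Fin.strictAnti_iff_succ_lt]
  intro i
  fin_cases i <;> simp [latinValues] at h0 h1 ⊢ <;> linarith

/-- Five distinct numbers among five candidates exhaust them. So `0` and `-1` do occur, and in the
natural ordering each relation has a known value. -/
theorem HasLatinKreinArray.range_eq (hK : O.HasLatinKreinArray m q) (hO : O.IsQPolynomial)
    {s : ℝ} (hs : 1 < s) (hsq : s ^ 2 = q) :
    Set.range (fun j => O.Q j 1 / m) = Set.range (latinValues s) := by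
  have hm := hK.m_pos hO
  have hinj : Function.Injective fun j => O.Q j 1 / m := fun j k h =>
    hO.Q_one_injective ((div_left_inj' hm.ne').1 h)
  have hg := (latinValues_strictAnti hs).injective
  have hsub : Finset.univ.image (fun j => O.Q j 1 / m) ⊆ Finset.univ.image (latinValues s) := by
    intro a ha
    obtain ⟨j, -, rfl⟩ := Finset.mem_image.1 ha
    rw [Finset.mem_image]
    rcases hK.values hO (by linarith) hsq j with h | h | h | h | h
    exacts [⟨0, Finset.mem_univ _, h.symm⟩, ⟨1, Finset.mem_univ _, h.symm⟩,
      ⟨2, Finset.mem_univ _, h.symm⟩, ⟨3, Finset.mem_univ _, h.symm⟩,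
      ⟨4, Finset.mem_univ _, h.symm⟩]
  have heq := Finset.eq_of_subset_of_card_le hsub (by
    rw [Finset.card_image_of_injective _ hinj, Finset.card_image_of_injective _ hg])
  simpa using congrArg (fun T : Finset ℝ => (T : Set ℝ)) heq

/-- The matrix `E₁`, normalized to have ones on the diagonal. -/
def gram (O : S.IdempotentOrdering) (m : ℝ) : Matrix X X ℝ :=
  ((Fintype.card X : ℝ) / m) • O.E 1

theorem gram_apply (O : S.IdempotentOrdering) {m : ℝ} {j : Fin 5} {x y : X}
    (h : (x, y) ∈ S.R j) : O.gram m x y = O.Q j 1 / m := by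
  rw [gram, Matrix.smul_apply, O.E_apply 1 h, smul_eq_mul]
  have := O.card_ne_zero
  field_simp

theorem HasLatinKreinArray.gram_sq (hK : O.HasLatinKreinArray m q) (hO : O.IsQPolynomial)
    (x y : X) : O.gram m x y ^ 2 = 1 / m + 2 * m / q * O.E 2 x y := by
  have h := O.E_mul_E_apply 1 1 x y
  rw [hK.krein_one_one hO, Fin.sum_univ_five, hK.card_eq hO] at h
  have hm := (hK.m_pos hO).ne'
  have hq := hK.q_ne_zero hO
  simp only [O.E_zero_apply, hK.card_eq hO] at h
  simp at h
  rw [gram, Matrix.smul_apply, smul_eq_mul, mul_pow, sq (O.E 1 x y), h, hK.card_eq hO]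
  field_simp

theorem HasLatinKreinArray.latinGram (hK : O.HasLatinKreinArray m q) (hO : O.IsQPolynomial)
    {s : ℝ} (hs : 1 < s) (hsq : s ^ 2 = q) : LatinGram (O.gram m) m s := by
  have hm := (hK.m_pos hO).ne'
  have hq := hK.q_ne_zero hO
  have hrange := hK.range_eq hO hs hsq
  refine ⟨hm, hs, ?_, ?_, ?_, ?_, ?_, ?_, ?_, ?_⟩
  · intro x y
    rw [gram, Matrix.smul_apply, Matrix.smul_apply, O.E_symm]
  · intro x
    rw [O.gram_apply (S.diag_mem x), hK.Q_zero_one hO, div_self hm]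
  · intro x y
    obtain ⟨j, hj⟩ := S.exists_mem x y
    rw [O.gram_apply hj]
    exact hK.values hO (by linarith) hsq j
  · intro x y h
    obtain ⟨j, hj⟩ := S.exists_mem x y
    rw [O.gram_apply hj, div_eq_one_iff_eq hm, ← hK.Q_zero_one hO] at h
    obtain rfl := hO.Q_one_injective h
    exact S.eq_of_mem_zero hj
  · intro x
    obtain ⟨j, hj⟩ : (-1 : ℝ) ∈ Set.range fun j => O.Q j 1 / m := hrange ▸ ⟨4, rfl⟩
    obtain ⟨y, hy⟩ := S.exists_neighbor j x
    exact ⟨y, (O.gram_apply hy).trans hj⟩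
  · obtain ⟨j, hj⟩ : (0 : ℝ) ∈ Set.range fun j => O.Q j 1 / m := hrange ▸ ⟨2, rfl⟩
    obtain ⟨⟨x, y⟩, hy⟩ := S.nonempty j
    exact ⟨x, y, (O.gram_apply hy).trans hj⟩
  · intro x y
    have h := O.sum_E_mul_E 1 1 x y
    rw [if_pos rfl] at h
    simp only [gram, Matrix.smul_apply, smul_eq_mul, mul_mul_mul_comm _ (O.E 1 x _),
      ← Finset.mul_sum, O.E_symm 1 y, h, hK.card_eq hO]
    field_simp
  · intro x y
    have h02 := O.sum_E_mul_E 2 0 x y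
    have h20 := O.sum_E_mul_E 2 0 y x
    have h22 := O.sum_E_mul_E 2 2 x y
    rw [if_neg (by decide)] at h02 h20
    rw [if_pos rfl] at h22
    simp only [O.E_zero_apply, ← Finset.sum_mul] at h02 h20
    have hn : (1 : ℝ) / Fintype.card X ≠ 0 := one_div_ne_zero O.card_ne_zero
    -- `E₂ E₀ = 0` with `E₀` constant: the rows of `E₂` sum to zero, so the cross terms in the
    -- fourth moment disappear.
    have hx : ∑ w, O.E 2 x w = 0 := (mul_eq_zero.1 h02).resolve_right hn
    have hy : ∑ w, O.E 2 y w = 0 := (mul_eq_zero.1 h20).resolve_right hn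
    have hxy : ∑ w, O.E 2 x w * O.E 2 y w = O.E 2 x y := by
      rw [← h22]
      exact Finset.sum_congr rfl fun w _ => by rw [O.E_symm 2 y w]
    have hexp : ∀ w, O.gram m x w ^ 2 * O.gram m y w ^ 2 =
        1 / m ^ 2 + 2 / q * O.E 2 x w + 2 / q * O.E 2 y w +
          (2 * m / q) ^ 2 * (O.E 2 x w * O.E 2 y w) := by
      intro w
      rw [hK.gram_sq hO, hK.gram_sq hO]
      field_simp
      ring
    rw [Finset.sum_congr rfl fun w _ => hexp w]
    simp only [Finset.sum_add_distrib, ← Finset.mul_sum, hx, hy, hxy, Finset.sum_const,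
      Finset.card_univ, nsmul_eq_mul, hK.card_eq hO, hK.gram_sq hO, hsq]
    field_simp
    ring

theorem HasLatinKreinArray.mem_iff (hK : O.HasLatinKreinArray m q) (hO : O.IsQPolynomial)
    (hN : O.IsNatural) {s : ℝ} (hs : 1 < s) (hsq : s ^ 2 = q) (j : Fin 5) (x y : X) :
    (x, y) ∈ S.R j ↔ O.gram m x y = latinValues s j := by
  have hm := hK.m_pos hO
  have hanti : StrictAnti fun j => O.Q j 1 / m := fun j k h =>
    div_lt_div_of_pos_right (hN h) hm
  have hval : (fun j => O.Q j 1 / m) = latinValues s :=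
    (hanti.range_inj (latinValues_strictAnti hs)).1 (hK.range_eq hO hs hsq)
  constructor
  · intro h
    rw [O.gram_apply h]
    exact congrFun hval j
  · intro h
    obtain ⟨k, hk⟩ := S.exists_mem x y
    rw [O.gram_apply hk] at h
    have : k = j := (latinValues_strictAnti hs).injective ((congrFun hval k).symm.trans h)
    exact this ▸ hk

theorem HasLatinKreinArray.tripleNumber_eq (hK : O.HasLatinKreinArray m q)
    (hO : O.IsQPolynomial) (hN : O.IsNatural) {s : ℝ} (hs : 1 < s) (hsq : s ^ 2 = q)
    {x y z : X} (hxy : (x, y) ∈ S.R 1) (hxz : (x, z) ∈ S.R 1) (hyz : (y, z) ∈ S.R 2) :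
    (S.tripleNumber x y z 1 1 3 : ℝ) =
      s + s ^ 2 * (1 - s) / 2 - m / 2 + S.tripleNumber x y z 1 1 1 := by
  have hmem := hK.mem_iff hO hN hs hsq
  have h := (hK.latinGram hO hs hsq).count_sub_count ((hmem 1 x y).1 hxy) ((hmem 1 x z).1 hxz)
    ((hmem 2 y z).1 hyz)
  simp only [tripleNumber, hmem]
  exact h

theorem HasLatinKreinArray.not_odd {m : ℤ} {s : ℕ} (hK : O.HasLatinKreinArray m (s ^ 2))
    (hO : O.IsQPolynomial) (hs : 1 < s) : ¬ Odd m := by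
  have hL := hK.latinGram hO (Nat.one_lt_cast.2 hs) rfl
  obtain ⟨x, y, z, hxy, hxz, hyz⟩ := hL.exists_triple
  have h := hL.count_sub_count hxy hxz hyz
  -- `(s - 1)s` is even, so `s²(1 - s)/2` is an integer.
  obtain ⟨a, ha⟩ := Int.even_mul_succ_self ((s : ℤ) - 1)
  generalize LatinGram.count _ x y z _ _ _ = b at h
  generalize LatinGram.count _ x y z _ _ _ = c at h
  have h2 : (m : ℝ) = ((2 * s + (s : ℤ) * (s * (1 - s)) - 2 * b + 2 * c : ℤ) : ℝ) := by
    push_cast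
    linarith
  have h3 := Int.cast_injective h2
  have h4 : m = 2 * (s - s * a - b + c) := by
    rw [h3]
    linear_combination (-(s : ℤ)) * ha
  rw [Int.not_odd_iff_even, h4]
  exact even_two_mul _

end IdempotentOrdering
end AssociationScheme

end

theorem mainTheorem4 {X : Type*} [Fintype X] [DecidableEq X] (S : AssociationScheme X 4)
    (O : S.IdempotentOrdering) (hO : O.IsQPolynomial) (m r : ℤ)
    (hKrein : O.HasKreinArray
      ![(m : ℝ), (m : ℝ) - 1, (m : ℝ) * ((r : ℝ) ^ 2 - 1) / (r : ℝ) ^ 2,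
        (m : ℝ) - (r : ℝ) ^ 2 + 1]
      ![1, (m : ℝ) / (r : ℝ) ^ 2, (r : ℝ) ^ 2 - 1, (m : ℝ)]) :
    ¬ Odd m ∧
    (0 < r → O.IsNatural → ∀ x y z : X,
      (x, y) ∈ S.R 1 → (x, z) ∈ S.R 1 → (y, z) ∈ S.R 2 →
      (S.tripleNumber x y z 1 1 3 : ℝ) =
        (r : ℝ) + (r : ℝ) ^ 2 * (1 - (r : ℝ)) / 2 - (m : ℝ) / 2
          + (S.tripleNumber x y z 1 1 1 : ℝ)) := by
  have hK : O.HasLatinKreinArray m ((r : ℝ) ^ 2) := hKrein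
  have h0 : r ≠ 0 := by
    rintro rfl
    exact hK.q_ne_zero hO (by simp)
  have h1 : r ^ 2 ≠ 1 := fun h => hK.q_ne_one hO (by exact_mod_cast h)
  have habs : 1 < r.natAbs := by
    have h2 : r.natAbs ≠ 1 := fun h => h1 (by rw [← Int.natAbs_sq, h]; rfl)
    have h3 : r.natAbs ≠ 0 := Int.natAbs_ne_zero.2 h0
    omega
  have hsq : ((r.natAbs : ℕ) : ℝ) ^ 2 = (r : ℝ) ^ 2 := by
    rw [Nat.cast_natAbs, Int.cast_abs, sq_abs]
  constructor
  · rw [← hsq] at hK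
    exact hK.not_odd hO habs
  · intro hr hN x y z hxy hxz hyz
    have hr1 : (1 : ℝ) < r := by
      have : 1 < r := by omega
      exact_mod_cast this
    exact hK.tripleNumber_eq hO hN hr1 rfl hxy hxz hyz
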